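/- All graphs are simple and undirected; $N[v]$ is the closed neighbourhood of a vertex $v$. A graph is *cop-win* if one cop has a winning strategy in the game of Cops and Robbers on it: the cop chooses a vertex, then the robber chooses a vertex, and then they move alternately with full information, the cop first, each move being to a vertex of the closed neighbourhood of the current one; the cop wins if at some (finite) time both are on the same vertex. For a graph $G$ and ordinals $\alpha$ define relations $\leq_\alpha$ on $V(G)$ recursively: $u\leq_0 u$ for every vertex $u$; and $u\leq_\alpha v$ if for every $x\in N[u]$ there is $y\in N[v]$ such that $x\leq_\beta y$ for some $\beta<\alpha$. The *CR-ordinal* $\rho(G)$ is the least ordinal $\rho$ such that the relations $\leq_\rho$ and $\leq_{\rho+1}$ coincide. Let $$\Lambda_T=\{\rho(T) : T \text{ is a cop-win tree}\}.$$ A *limit ordinal* is a nonzero ordinal that is not a successor. **Theorem 3.1.** A tree is cop-win if and only if it is rayless (contains no one-way infinite path as a subgraph). The CR-ordinal of a cop-win tree is either a finite ordinal or of the form $\alpha+\omega$ with $\alpha$ a limit ordinal. Every such ordinal is the CR-ordinal of some cop-win tree, so $$\Lambda_T=\omega\cup\{\alpha+\omega : \alpha \text{ is a limit ordinal}\}.$$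 -/

import Mathlib

universe u

namespace CopsRobbers

/-- One move in the game on `G`: stay where you are, or go along an edge. Equivalently, `y` lies in
the closed neighbourhood `N[x]`. -/
def Step {V : Type u} (G : SimpleGraph V) (x y : V) : Prop :=
  y = x ∨ G.Adj x y

/-- The first `n` positions `r 0, …, r (n - 1)` of the robber. -/
def history {V : Type u} (r : ℕ → V) (n : ℕ) : List V :=
  (List.range n).map r

/-- `G` is cop-win: one cop has a winning strategy in the game of Cops and Robbers on `G`.

The cop chooses a vertex, then the robber chooses a vertex `r 0`; afterwards they move alternately,
the cop first, with full information. A (history dependent) strategy `σ` of the cop sends the list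
of the robber's positions so far to the cop's next position: `σ []` is the starting vertex of the
cop, and `σ [r 0, …, r n]` is the position of the cop after the move that answers `r n`. The
strategy has to make legal moves against every legal play `r` of the robber, and at some point the
cop and the robber have to be on the same vertex, after a move of the cop or of the robber. -/
def CopWin {V : Type u} (G : SimpleGraph V) : Prop :=
  ∃ σ : List V → V, ∀ r : ℕ → V, (∀ n, Step G (r n) (r (n + 1))) →
    (∀ n, Step G (σ (history r n)) (σ (history r (n + 1)))) ∧
    ∃ n, σ (history r (n + 1)) = r n ∨ σ (history r n) = r n

/-- `G` has no ray, that is, no one-way infinite path as a subgraph. -/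
def Rayless {V : Type u} (G : SimpleGraph V) : Prop :=
  ¬ ∃ f : ℕ → V, Function.Injective f ∧ ∀ n, G.Adj (f n) (f (n + 1))

/-- The relation `u ≤_α v` on the vertices of `G`: either `α = 0` and `u = v`, or for all
`x ∈ N[u]` there is `y ∈ N[v]` such that `x ≤_β y` for some `β < α`. -/
def CaptureLE {V : Type u} (G : SimpleGraph V) (α : Ordinal.{u}) (a b : V) : Prop :=
  (α = 0 ∧ a = b) ∨
    ∀ x, Step G a x → ∃ y, Step G b y ∧ ∃ β, ∃ _ : β < α, CaptureLE G β x y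
termination_by α

/-- The ordinals `ρ` at which the tower of relations stabilizes: `≤_ρ` equals `≤_{ρ+1}`. -/
def stableOrdinals {V : Type u} (G : SimpleGraph V) : Set Ordinal.{u} :=
  {ρ | CaptureLE G ρ = CaptureLE G (ρ + 1)}

/-- The CR-ordinal `ρ(G)`: the least `ρ` such that `≤_ρ` equals `≤_{ρ+1}`. -/
noncomputable def crOrdinal {V : Type u} (G : SimpleGraph V) : Ordinal.{u} :=
  sInf (stableOrdinals G)

/-- `Λ_T`, the set of CR-ordinals of cop-win trees. -/
def treeCROrdinals : Set Ordinal.{u} :=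
  {ρ | ∃ (V : Type u) (T : SimpleGraph V), T.IsTree ∧ CopWin T ∧ crOrdinal T = ρ}

theorem captureLE_self {V : Type u} (G : SimpleGraph V) (α : Ordinal.{u}) (a : V) :
    CaptureLE G α a a := by
  induction α using WellFoundedLT.induction generalizing a with
  | ind α ih =>
    rw [CaptureLE]
    by_cases h : α = 0
    · exact Or.inl ⟨h, rfl⟩
    · have h0 : 0 < α := pos_iff_ne_zero.2 h
      exact Or.inr fun x hx => ⟨x, hx, 0, h0, ih 0 h0 x⟩

theorem captureLE_mono {V : Type u} (G : SimpleGraph V) {α β : Ordinal.{u}} (h : α ≤ β)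
    {a b : V} (hab : CaptureLE G α a b) : CaptureLE G β a b := by
  rw [CaptureLE] at hab
  rcases hab with ⟨_, rfl⟩ | hab
  · exact captureLE_self G β a
  · rw [CaptureLE]
    right
    intro x hx
    obtain ⟨y, hy, γ, hγ, hxy⟩ := hab x hx
    exact ⟨y, hy, γ, hγ.trans_le h, hxy⟩

/-- The tower of relations does stabilize, so the infimum in `crOrdinal` is a minimum. -/
theorem stableOrdinals_nonempty {V : Type u} (G : SimpleGraph V) :
    (stableOrdinals G).Nonempty := by
  by_contra hne
  refine not_injective_of_ordinal (fun α : Ordinal.{u} => CaptureLE G α) ?_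
  have key : ∀ α β : Ordinal.{u}, α < β → CaptureLE G α ≠ CaptureLE G β := by
    intro α β hlt heq
    refine hne ⟨α, ?_⟩
    change CaptureLE G α = CaptureLE G (α + 1)
    funext a b
    refine propext ⟨captureLE_mono G (le_self_add), fun h => ?_⟩
    rw [heq]
    exact captureLE_mono G (Order.add_one_le_of_lt hlt) h
  intro α β heq
  rcases lt_trichotomy α β with h | h | h
  · exact absurd heq (key α β h)
  · exact h
  · exact absurd heq.symm (key β α h)

theorem crOrdinal_isLeast {V : Type u} (G : SimpleGraph V) :
    IsLeast (stableOrdinals G) (crOrdinal G) :=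
  ⟨csInf_mem (stableOrdinals_nonempty G), fun _ h => csInf_le' h⟩

end CopsRobbers

/-!
The proof assigns an ordinal rank to every edge of a rayless tree and reads everything off these
ranks.

Call an edge `(b, c)` a successor of `(a, b)` if `c ≠ a` (`Onward`). A non-backtracking infinite
walk in a tree is a ray, so in a rayless tree this relation is well-founded, and then
`branchRank T a b` is the rank of `(a, b)`, that is, of the branch at `a` through `b`; the pair
`(t, t)` stands for the whole tree with root `t`. A cop who moves towards the robber walks along
successive edges, so well-foundedness makes the cop win. On a ray, conversely, a robber with a
sufficient lead runs away for ever (`copWin_iff_rayless`).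

The same strategies compute the relations `≤_α`. If the robber is on `u` and the cop on `v`, and
`w` is the neighbour of `v` towards `u`, then `u ≤_α v` for `α = 1 + branchRank T v w`
(`captureLE_of_dist_lt`), and for adjacent `u` and `v` no smaller `α` will do
(`one_add_branchRank_le_of_captureLE`). Hence the CR-ordinal is the supremum of
`1 + branchRank T a b` over all edges `(a, b)` (`crOrdinal_le_iff`).

Let `R` be the rank of the tree with root `t`. Edges pointing away from `t` have rank below `R`,
and edges pointing towards `t` have rank at most `R` plus their distance from `t`. If `R` is finite,
then so are all distances, and the CR-ordinal is finite. Otherwise `l ≤ R < l + ω` for a limit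
ordinal `l`, and the CR-ordinal is at most `l + ω`. It is not smaller (`add_omega0_le_crOrdinal`):
some vertex `v` has branches of ranks cofinal in `l`, so one can walk arbitrarily far into one of
them, and looking back after `n + 1` steps one sees a branch of rank at least `l + n`, because the
other branches at `v` are still cofinal in `l`.

Paths realize the finite ordinals, and the tree of descending sequences of ordinals below `l`, which
has rank `l`, realizes `l + ω`. Both are trees of lists (`listTree`).
-/

namespace CopsRobbers

/-! ### Distances in a tree -/

section Distance

variable {V : Type u} {T : SimpleGraph V}

theorem exists_adj_dist_lt (hT : T.IsTree) {t v : V} (h : v ≠ t) :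
    ∃ w, T.Adj v w ∧ T.dist t w < T.dist t v := by
  obtain ⟨p, hp⟩ := hT.1.exists_walk_length_eq_dist v t
  cases p with
  | nil => exact absurd rfl h
  | @cons _ w _ hvw q =>
    refine ⟨w, hvw, ?_⟩
    have := SimpleGraph.dist_le q
    rw [SimpleGraph.Walk.length_cons] at hp
    rw [SimpleGraph.dist_comm (u := t), SimpleGraph.dist_comm (u := t)]
    omega

theorem eq_of_adj_of_dist_lt (hT : T.IsTree) {t v x y : V} (hx : T.Adj v x) (hy : T.Adj v y)
    (hxt : T.dist t x < T.dist t v) (hyt : T.dist t y < T.dist t v) : x = y := by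
  have key : ∀ z, T.Adj v z → T.dist t z < T.dist t v →
      ∃ q : T.Walk t v, q.IsPath ∧ q.penultimate = z := by
    intro z hz hzt
    obtain ⟨p, hp⟩ := hT.1.exists_walk_length_eq_dist t z
    refine ⟨p.concat hz.symm, ?_, by simp⟩
    apply SimpleGraph.Walk.isPath_of_length_eq_dist
    have := hT.dist_eq_dist_add_one_of_adj t hz
    rw [SimpleGraph.Walk.length_concat]
    omega
  obtain ⟨p, hp, rfl⟩ := key x hx hxt
  obtain ⟨q, hq, rfl⟩ := key y hy hyt
  rw [(hT.existsUnique_path t v).unique hp hq]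

theorem dist_eq_add_one_of_ne (hT : T.IsTree) {t v x y : V} (hx : T.Adj v x) (hy : T.Adj v y)
    (hxt : T.dist t x < T.dist t v) (hne : y ≠ x) : T.dist t y = T.dist t v + 1 := by
  have := hT.dist_eq_dist_add_one_of_adj t hy
  by_contra hlt
  exact hne (eq_of_adj_of_dist_lt hT hy hx (by omega) hxt)

/-- The branch at `v` through its neighbour `w` can only be left through `v`: if `u` lies in it,
so does every `x ≠ v` in the closed neighbourhood of `u`. -/
theorem dist_lt_of_step (hT : T.IsTree) {u v w x : V} (hvw : T.Adj v w)
    (hu : T.dist u w < T.dist u v) (hux : Step T u x) (hxv : x ≠ v) :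
    T.dist x w < T.dist x v := by
  rcases hux with rfl | hux
  · exact hu
  by_contra hlt
  have h1 := hT.dist_eq_dist_add_one_of_adj x hvw
  have h2 := hT.dist_eq_dist_add_one_of_adj u hvw
  have h3 := hT.dist_eq_dist_add_one_of_adj v hux
  have h4 := hT.dist_eq_dist_add_one_of_adj w hux
  simp only [SimpleGraph.dist_comm (u := x), SimpleGraph.dist_comm (u := u)] at *
  have huw : u ≠ w := by
    rintro rfl
    have e1 := SimpleGraph.dist_eq_one_iff_adj.2 hvw
    have e2 := SimpleGraph.dist_eq_one_iff_adj.2 hux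
    have : T.dist v x = 0 := by omega
    exact hxv ((hT.1.dist_eq_zero_iff).1 this).symm
  -- `z` is closer than `u` to both `v` and `w`, so `z = x`, which is farther from `w`
  obtain ⟨z, huz, hz⟩ := exists_adj_dist_lt hT huw
  have h5 := hT.1.dist_triangle (u := v) (v := w) (w := z)
  rw [SimpleGraph.dist_eq_one_iff_adj.2 hvw] at h5
  have := eq_of_adj_of_dist_lt hT (t := v) huz hux (by omega) (by omega)
  subst this
  omega

/-- Once a non-backtracking walk in a tree moves away from `t`, it does so forever. -/
theorem dist_add_of_nonbacktracking (hT : T.IsTree) {f : ℕ → V}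
    (hadj : ∀ n, T.Adj (f n) (f (n + 1))) (hne : ∀ n, f (n + 2) ≠ f n) {t : V} {m : ℕ}
    (hm : T.dist t (f m) < T.dist t (f (m + 1))) (k : ℕ) :
    T.dist t (f (m + k)) = T.dist t (f m) + k := by
  suffices h : ∀ k, T.dist t (f (m + k)) = T.dist t (f m) + k ∧
      T.dist t (f (m + k)) < T.dist t (f (m + k + 1)) from (h k).1
  intro k
  induction k with
  | zero => exact ⟨rfl, hm⟩
  | succ k ih =>
    have h1 := hT.dist_eq_dist_add_one_of_adj t (hadj (m + k))
    have h2 := dist_eq_add_one_of_ne hT (hadj (m + k)).symm (hadj (m + k + 1)) ih.2 (hne (m + k))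
    rw [← add_assoc]
    omega

theorem exists_dist_lt_dist_succ (hT : T.IsTree) {f : ℕ → V}
    (hadj : ∀ n, T.Adj (f n) (f (n + 1))) (t : V) :
    ∃ m, T.dist t (f m) < T.dist t (f (m + 1)) := by
  by_contra! h
  have key : ∀ n, T.dist t (f n) + n ≤ T.dist t (f 0) := by
    intro n
    induction n with
    | zero => simp
    | succ n ih =>
      have := h n
      have := hT.dist_eq_dist_add_one_of_adj t (hadj n)
      omega
  have := key (T.dist t (f 0) + 1)
  omega

end Distance

/-! ### Continuing a walk without turning back -/

section Onward

variable {V : Type u} {T : SimpleGraph V}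

/-- `Onward G q p` says that the pair `p = (a, b)` is followed by `q = (b, c)`, where `c` is a
neighbour of `b` other than `a`. The pair `p` need not be an edge: below `(t, t)` lie all pairs
`(t, c)` with `c` a neighbour of `t`, so that `(t, t)` stands for the tree rooted at `t`, while an
edge `(a, b)` stands for the branch at `a` through `b`. -/
def Onward (G : SimpleGraph V) (q p : V × V) : Prop :=
  q.1 = p.2 ∧ G.Adj q.1 q.2 ∧ q.2 ≠ p.1

theorem Onward.mk {G : SimpleGraph V} {a b c : V} (h : G.Adj b c) (hne : c ≠ a) :
    Onward G (b, c) (a, b) :=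
  ⟨rfl, h, hne⟩

theorem wellFounded_of_rayless (hT : T.IsTree) (h : Rayless T) : WellFounded (Onward T) := by
  refine wellFounded_iff_isEmpty_descending_chain.2 ⟨fun ⟨g, hg⟩ => h ?_⟩
  have h2 : ∀ n, (g (n + 1)).2 = (g (n + 2)).1 := fun n => (hg (n + 1)).1.symm
  have hadj : ∀ n, T.Adj (g (n + 1)).1 (g (n + 2)).1 := fun n => h2 n ▸ (hg n).2.1
  have hne : ∀ n, (g (n + 3)).1 ≠ (g (n + 1)).1 := fun n => h2 (n + 1) ▸ (hg (n + 1)).2.2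
  refine ⟨fun n => (g (n + 1)).1, ?_, hadj⟩
  refine .of_lt_imp_ne fun m n hlt (heq : (g (m + 1)).1 = (g (n + 1)).1) => ?_
  obtain ⟨k, rfl⟩ := Nat.exists_eq_add_of_lt hlt
  have := dist_add_of_nonbacktracking hT (f := fun n => (g (n + 1)).1) hadj hne
    (t := (g (m + 1)).1) (m := m)
    (by simp [SimpleGraph.dist_eq_one_iff_adj.2 (hadj m)]) (k + 1)
  rw [← add_assoc, ← heq] at this
  simp at this

/-- The edges of a ray finally point away from `t`, and such edges are reached from `(t, t)`. -/
theorem rayless_of_acc (hT : T.IsTree) {t : V} (h : Acc (Onward T) (t, t)) : Rayless T := by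
  have hacc : ∀ n a b, T.Adj a b → T.dist t a < T.dist t b → T.dist t a = n →
      Acc (Onward T) (a, b) := by
    intro n
    induction n with
    | zero =>
      intro a b hab _ ha
      obtain rfl := (hT.1.dist_eq_zero_iff).1 ha
      exact h.inv (Onward.mk hab hab.ne')
    | succ n ih =>
      intro a b hab hlt ha
      obtain ⟨c, hac, hc⟩ := exists_adj_dist_lt hT (t := t) (v := a) (by rintro rfl; simp at ha)
      have := hT.dist_eq_dist_add_one_of_adj t hac
      refine (ih c a hac.symm hc (by omega)).inv (Onward.mk hab ?_)
      rintro rfl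
      omega
  rintro ⟨f, hinj, hadj⟩
  have hne : ∀ n, f (n + 2) ≠ f n := fun n h => by have := hinj h; omega
  obtain ⟨m, hm⟩ := exists_dist_lt_dist_succ hT hadj t
  have hchain := (acc_iff_isEmpty_descending_chain (r := Onward T)
    (x := (f m, f (m + 1)))).1 (hacc _ _ _ (hadj m) hm rfl)
  exact hchain.elim ⟨fun n => (f (m + n), f (m + n + 1)), rfl, fun n =>
    Onward.mk (hadj _) (hne _)⟩

end Onward

/-! ### The game on a tree -/

section Game

variable {V : Type u} {T : SimpleGraph V}

theorem history_succ (r : ℕ → V) (n : ℕ) : history r (n + 1) = history r n ++ [r n] := by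
  simp [history, List.range_succ]

/-- The cop always moves towards the robber. As long as the robber is not caught, the moves of the
cop never turn back, so they follow a descending chain of `Onward T`. -/
theorem copWin_of_wellFounded (hT : T.IsTree) (hwf : WellFounded (Onward T)) : CopWin T := by
  have hnext : ∀ c r : V, ∃ d, Step T c d ∧
      (c ≠ r → T.Adj c d ∧ T.dist r d < T.dist r c) := by
    intro c r
    by_cases h : c = r
    · exact ⟨c, Or.inl rfl, fun h' => absurd h h'⟩
    · obtain ⟨d, hd, hlt⟩ := exists_adj_dist_lt hT h
      exact ⟨d, Or.inr hd, fun _ => ⟨hd, hlt⟩⟩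
  choose next hstep hcloser using hnext
  obtain ⟨t⟩ := hT.1.nonempty
  refine ⟨fun l => l.foldl next t, fun r hr => ?_⟩
  have hc : ∀ n, (history r (n + 1)).foldl next t = next ((history r n).foldl next t) (r n) :=
    fun n => by rw [history_succ, List.foldl_append]; rfl
  refine ⟨fun n => by simpa only [hc] using hstep _ _, ?_⟩
  by_contra! hfree
  set c : ℕ → V := fun n => (history r n).foldl next t with hcdef
  replace hc : ∀ n, T.Adj (c n) (c (n + 1)) ∧ T.dist (r n) (c (n + 1)) < T.dist (r n) (c n) :=
    fun n => by simpa only [hcdef, hc] using hcloser _ _ (hfree n).2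
  refine (wellFounded_iff_isEmpty_descending_chain.1 hwf).elim
    ⟨fun n => (c n, c (n + 1)), fun n => Onward.mk (hc _).1 fun heq => ?_⟩
  have hback : r (n + 1) ≠ c n := by
    intro h
    have h1 : T.dist (r n) (c n) ≤ 1 := by
      rw [← h]
      rcases hr n with h' | h'
      · simp [h']
      · exact (SimpleGraph.dist_eq_one_iff_adj.2 h').le
    have h0 : T.dist (r n) (c (n + 1)) = 0 := by have := (hc n).2; omega
    exact (hfree n).1 ((hT.1.dist_eq_zero_iff).1 h0).symm
  have h1 := dist_lt_of_step hT (hc n).1 (hc n).2 (hr n) hback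
  have h2 := (hc (n + 1)).2
  rw [show c (n + 1 + 1) = c n from heq] at h2
  omega

/-- On a ray the robber starts ahead of the cop and runs away from the starting point of the cop:
then the distance to this point always exceeds the number of moves made by the cop. -/
theorem rayless_of_copWin (hT : T.IsTree) (h : CopWin T) : Rayless T := by
  rintro ⟨f, hinj, hadj⟩
  obtain ⟨σ, hσ⟩ := h
  have hne : ∀ n, f (n + 2) ≠ f n := fun n h => by have := hinj h; omega
  obtain ⟨m, hm⟩ := exists_dist_lt_dist_succ hT hadj (σ [])
  have hdist := dist_add_of_nonbacktracking hT hadj hne hm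
  obtain ⟨hlegal, n, hn⟩ := hσ (fun n => f (m + (2 + n))) fun n => Or.inr (hadj _)
  have hcop : ∀ n, T.dist (σ []) (σ (history (fun n => f (m + (2 + n))) n)) ≤ n := by
    intro n
    induction n with
    | zero => simp [history]
    | succ n ih =>
      refine hT.1.dist_triangle.trans (add_le_add ih ?_)
      rcases hlegal n with h | h
      · simp [h]
      · exact (SimpleGraph.dist_eq_one_iff_adj.2 h).le
  have h1 := hdist (2 + n)
  rcases hn with hn | hn
  · have h2 := hcop (n + 1)
    rw [hn, h1] at h2
    omega
  · have h2 := hcop n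
    rw [hn, h1] at h2
    omega

theorem copWin_iff_rayless (hT : T.IsTree) : CopWin T ↔ Rayless T :=
  ⟨rayless_of_copWin hT, fun h => copWin_of_wellFounded hT (wellFounded_of_rayless hT h)⟩

end Game


/-! ### Ranks of branches and the relations `≤_α` -/

section BranchRank

variable {V : Type u} {T : SimpleGraph V} [IsWellFounded (V × V) (Onward T)]

/-- The rank of the pair `(a, b)` in the well-founded relation `Onward T`: the rank of the branch
at `a` through `b`, rooted at `b`, when `a` and `b` are adjacent, and the rank of the whole tree,
rooted at `a`, when `a = b`. A single vertex has rank `0`. -/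
noncomputable def branchRank (T : SimpleGraph V) [IsWellFounded (V × V) (Onward T)] (a b : V) :
    Ordinal.{u} :=
  IsWellFounded.rank (Onward T) (a, b)

theorem branchRank_lt {a b c : V} (h : T.Adj b c) (hne : c ≠ a) :
    branchRank T b c < branchRank T a b :=
  IsWellFounded.rank_lt_of_rel (Onward.mk h hne)

theorem branchRank_le {a b : V} {o : Ordinal.{u}}
    (h : ∀ c, T.Adj b c → c ≠ a → branchRank T b c < o) : branchRank T a b ≤ o := by
  rw [branchRank, IsWellFounded.rank_eq]
  refine Ordinal.iSup_le fun ⟨⟨b', c⟩, hb, hadj, hne⟩ => ?_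
  obtain rfl : b' = b := hb
  exact Order.succ_le_of_lt (h c hadj hne)

theorem exists_le_branchRank {a b : V} {o : Ordinal.{u}} (h : o < branchRank T a b) :
    ∃ c, T.Adj b c ∧ c ≠ a ∧ o ≤ branchRank T b c := by
  by_contra! hc
  exact (branchRank_le hc).not_gt h

/-- If the robber is in the branch at `v` through `w`, then the cop on `v` moves to `w` and leaves
the robber with a branch of smaller rank. -/
theorem captureLE_of_dist_lt (hT : T.IsTree) {u v w : V} (hvw : T.Adj v w)
    (hu : T.dist u w < T.dist u v) : CaptureLE T (1 + branchRank T v w) u v := by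
  induction h : branchRank T v w using WellFoundedLT.induction generalizing u v w with
  | ind o ih =>
    subst h
    rw [CaptureLE]
    refine Or.inr fun x hx => ?_
    have hpos : (0 : Ordinal) < 1 + branchRank T v w :=
      zero_lt_one.trans_le le_self_add
    by_cases hxv : x = v
    · exact ⟨v, Or.inl rfl, 0, hpos, hxv ▸ captureLE_self T 0 x⟩
    refine ⟨w, Or.inr hvw, ?_⟩
    by_cases hxw : x = w
    · exact ⟨0, hpos, hxw ▸ captureLE_self T 0 x⟩
    have hlt := dist_lt_of_step hT hvw hu hx hxv
    obtain ⟨w', hw', hlt'⟩ := exists_adj_dist_lt hT (Ne.symm hxw)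
    have hne : w' ≠ v := by rintro rfl; omega
    have hrank := branchRank_lt hw' hne
    exact ⟨1 + branchRank T w w', by gcongr, ih _ hrank hw' hlt' rfl⟩

/-- The robber on `u` keeps away from the cop on `v` by going on within the branch at `z` through
`u`, where `z` is the neighbour of `u` in the direction of the cop. -/
theorem one_add_branchRank_le_of_captureLE (hT : T.IsTree) {α : Ordinal.{u}} {u v z : V}
    (h : CaptureLE T α u v) (huz : T.Adj u z) (hz : T.dist v z < T.dist v u) :
    1 + branchRank T z u ≤ α := by
  induction α using WellFoundedLT.induction generalizing u v z with
  | ind α ih =>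
    rw [CaptureLE] at h
    rcases h with ⟨_, rfl⟩ | h
    · simp at hz
    have hpos : 1 ≤ α := by
      obtain ⟨_, _, β, hβ, _⟩ := h u (Or.inl rfl)
      exact Order.one_le_iff_pos.2 (pos_of_gt hβ)
    rw [← Ordinal.add_sub_cancel_of_le hpos]
    gcongr
    refine branchRank_le fun x hux hxz => ?_
    obtain ⟨y, hvy, β, hβ, hxy⟩ := h x (Or.inr hux)
    have hxv := dist_eq_add_one_of_ne hT huz hux hz hxz
    have hyv : T.dist v y ≤ 1 := by
      rcases hvy with rfl | hvy
      · simp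
      · exact (SimpleGraph.dist_eq_one_iff_adj.2 hvy).le
    have hlt : T.dist y u < T.dist y x :=
      dist_lt_of_step hT hux.symm (by omega) hvy (by rintro rfl; omega)
    have := (ih β hβ hxy hux.symm hlt).trans_lt hβ
    rwa [← Ordinal.add_sub_cancel_of_le hpos, add_lt_add_iff_left] at this

theorem captureLE_eq_of_le {V : Type u} {G : SimpleGraph V} {ρ σ : Ordinal.{u}}
    (h : CaptureLE G ρ = CaptureLE G (ρ + 1)) (hσ : ρ ≤ σ) : CaptureLE G σ = CaptureLE G ρ := by
  induction σ using WellFoundedLT.induction with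
  | ind σ ih =>
    rcases hσ.eq_or_lt with rfl | hlt
    · rfl
    funext a b
    refine propext ⟨fun hab => ?_, captureLE_mono G hσ⟩
    rw [CaptureLE] at hab
    rcases hab with ⟨_, rfl⟩ | hab
    · exact captureLE_self G ρ a
    rw [h, CaptureLE]
    refine Or.inr fun x hx => ?_
    obtain ⟨y, hy, β, hβ, hxy⟩ := hab x hx
    refine ⟨y, hy, ρ, Order.lt_add_one_iff.2 le_rfl, ?_⟩
    rcases le_total ρ β with hle | hle
    · exact ih β hβ hle ▸ hxy
    · exact captureLE_mono G hle hxy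

/-- Every pair of vertices satisfies some `≤_α`, so the relations become stable exactly when they
become total. -/
theorem crOrdinal_le_iff (hT : T.IsTree) {ρ : Ordinal.{u}} :
    crOrdinal T ≤ ρ ↔ ∀ a b, T.Adj a b → 1 + branchRank T a b ≤ ρ := by
  constructor
  · intro h a b hab
    have hlt : T.dist a a < T.dist a b := by
      simp [SimpleGraph.dist_eq_one_iff_adj.2 hab]
    have hlt' : T.dist b b < T.dist b a := by
      simp [SimpleGraph.dist_eq_one_iff_adj.2 hab.symm]
    have hstable := (crOrdinal_isLeast T).1
    have hcap := captureLE_of_dist_lt hT hab hlt'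
    refine one_add_branchRank_le_of_captureLE hT (captureLE_mono T h ?_) hab.symm hlt
    rw [← captureLE_eq_of_le hstable (le_max_left _ (1 + branchRank T a b))]
    exact captureLE_mono T (le_max_right _ _) hcap
  · intro h
    have htotal : ∀ a b, CaptureLE T ρ a b := by
      intro a b
      by_cases hab : b = a
      · exact hab ▸ captureLE_self T ρ b
      · obtain ⟨w, hw, hlt⟩ := exists_adj_dist_lt hT hab
        exact captureLE_mono T (h b w hw) (captureLE_of_dist_lt hT hw hlt)
    refine (crOrdinal_isLeast T).2 ?_
    change CaptureLE T ρ = CaptureLE T (ρ + 1)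
    funext a b
    exact propext (iff_of_true (htotal a b) (captureLE_mono T le_self_add (htotal a b)))

end BranchRank

/-! ### The possible values of the CR-ordinal -/

section Values

open Ordinal

variable {V : Type u} {T : SimpleGraph V} [IsWellFounded (V × V) (Onward T)]

theorem branchRank_add_dist_le (hT : T.IsTree) (t : V) {a b : V} (hab : T.Adj a b)
    (h : T.dist t a < T.dist t b) : branchRank T a b + T.dist t b ≤ branchRank T t t := by
  induction hn : T.dist t a generalizing a b with
  | zero =>
    obtain rfl := (hT.1.dist_eq_zero_iff).1 hn
    rw [SimpleGraph.dist_eq_one_iff_adj.2 hab, Nat.cast_one, Order.add_one_le_iff]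
    exact branchRank_lt hab hab.ne'
  | succ n ih =>
    obtain ⟨c, hac, hc⟩ := exists_adj_dist_lt hT (t := t) (v := a) (by rintro rfl; simp at hn)
    have h1 := hT.dist_eq_dist_add_one_of_adj t hac
    have h2 := hT.dist_eq_dist_add_one_of_adj t hab
    have hlt : branchRank T a b < branchRank T c a :=
      branchRank_lt hab (by rintro rfl; omega)
    have hd : T.dist t b = 1 + T.dist t a := by omega
    rw [hd, Nat.cast_add, ← add_assoc, Nat.cast_one]
    exact (add_le_add_left (Order.add_one_le_of_lt hlt) _).trans (ih hac.symm hc (by omega))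

theorem branchRank_le_add_dist (hT : T.IsTree) (t : V) {a b : V} (hab : T.Adj a b) :
    branchRank T a b ≤ branchRank T t t + T.dist t b := by
  induction hn : T.dist t b generalizing a b with
  | zero =>
    obtain rfl := (hT.1.dist_eq_zero_iff).1 hn
    simpa using branchRank_le fun c hc _ => branchRank_lt hc hc.ne'
  | succ n ih =>
    refine branchRank_le fun c hbc _ => ?_
    have hn' : branchRank T t t + (n : Ordinal.{u}) < branchRank T t t + ((n + 1 : ℕ) : Ordinal) := by
      simp
    have := hT.dist_eq_dist_add_one_of_adj t hbc
    rcases lt_or_ge (T.dist t c) (T.dist t b) with h | h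
    · exact (ih hbc (by omega)).trans_lt hn'
    · exact ((le_self_add.trans (branchRank_add_dist_le hT t hbc (by omega))).trans
        le_self_add).trans_lt hn'

theorem crOrdinal_lt_omega0 (hT : T.IsTree) (t : V) (h : branchRank T t t < ω) :
    crOrdinal T < ω := by
  obtain ⟨k, hk⟩ := lt_omega0.1 h
  refine lt_of_le_of_lt ?_ (natCast_lt_omega0 (1 + (k + k)))
  refine (crOrdinal_le_iff hT).2 fun a b hab => ?_
  have hdist : T.dist t b ≤ k := by
    by_cases hb : b = t
    · simp [hb]
    obtain ⟨c, hbc, hc⟩ := exists_adj_dist_lt hT hb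
    have := le_add_self.trans (branchRank_add_dist_le hT t hbc.symm hc)
    rw [hk] at this
    exact_mod_cast this
  have h1 := branchRank_le_add_dist hT t hab
  rw [hk] at h1
  push_cast
  gcongr
  exact h1.trans (by gcongr; )

theorem crOrdinal_le_add_omega0 (hT : T.IsTree) {t : V} {l : Ordinal.{u}} (hl : Order.IsSuccLimit l)
    (h : branchRank T t t < l + ω) : crOrdinal T ≤ l + ω := by
  refine (crOrdinal_le_iff hT).2 fun a b hab => ?_
  obtain ⟨d, hd, hle⟩ := (lt_add_iff omega0_ne_zero).1 h
  rw [← one_add_of_omega0_le (omega0_le_of_isSuccLimit hl), add_assoc]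
  gcongr
  refine (branchRank_le_add_dist hT t hab).trans ?_
  calc _ ≤ l + d + T.dist t b := by gcongr
    _ = l + (d + T.dist t b) := add_assoc _ _ _
    _ ≤ l + ω := by
      gcongr
      exact (isPrincipal_add_omega0 hd (natCast_lt_omega0 _)).le

/-- Walking `n` steps into the branch at `v` through `x`, and looking back from there, one sees
the branch at `x` through `v` at distance `n`. -/
theorem exists_add_le_branchRank {n : ℕ} {v x : V} {o : Ordinal.{u}} (hvx : T.Adj v x)
    (hn : n ≤ branchRank T v x) (ho : o ≤ branchRank T x v) :
    ∃ a b, T.Adj a b ∧ o + n ≤ branchRank T a b := by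
  induction n generalizing v x o with
  | zero => exact ⟨x, v, hvx.symm, by simpa using ho⟩
  | succ n ih =>
    have hlt : (n : Ordinal.{u}) < branchRank T v x :=
      lt_of_lt_of_le (by exact_mod_cast n.lt_succ_self) hn
    obtain ⟨y, hxy, hyv, hle⟩ := exists_le_branchRank hlt
    obtain ⟨a, b, hab, h⟩ := ih hxy hle
      (Order.add_one_le_of_lt (ho.trans_lt (branchRank_lt hvx.symm hyv.symm)))
    refine ⟨a, b, hab, le_trans (le_of_eq ?_) h⟩
    rw [add_assoc, add_comm n, Nat.cast_add, Nat.cast_one]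

/-- Take a pair `(p, v)` of rank at least `l` all of whose successors have rank below `l`. The
ranks of the branches at `v` are cofinal in `l`, even if one of them is left out; so `v`, seen from
any of its neighbours, has rank at least `l`, and there are arbitrarily long ways to leave `v`. -/
theorem add_omega0_le_crOrdinal (hT : T.IsTree) {t : V} {l : Ordinal.{u}} (hl : Order.IsSuccLimit l)
    (h : l ≤ branchRank T t t) : l + ω ≤ crOrdinal T := by
  obtain ⟨⟨p, v⟩, hpv, hmin⟩ := (IsWellFounded.wf (r := Onward T)).has_min
    {q : V × V | l ≤ branchRank T q.1 q.2} ⟨(t, t), h⟩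
  have hsmall : ∀ x, T.Adj v x → x ≠ p → branchRank T v x < l := fun x hx hne =>
    lt_of_not_ge fun hle => hmin (v, x) hle (Onward.mk hx hne)
  have hback : ∀ x, T.Adj v x → x ≠ p → l ≤ branchRank T x v := by
    intro x hx hxp
    refine le_of_forall_lt fun o ho => ?_
    have hmax : max o (branchRank T v x + 1) < l :=
      max_lt ho (hl.add_one_lt (hsmall x hx hxp))
    obtain ⟨y, hy, _, hle⟩ := exists_le_branchRank (hmax.trans_le hpv)
    have hyx : y ≠ x := by
      rintro rfl
      exact ((le_max_right _ _).trans hle).not_gt (Order.lt_add_one_iff.2 le_rfl)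
    exact ((le_max_left _ _).trans hle).trans_lt (branchRank_lt hy hyx)
  refine le_of_forall_lt fun o ho => ?_
  obtain ⟨d, hd, hod⟩ := (lt_add_iff omega0_ne_zero).1 ho
  obtain ⟨n, rfl⟩ := lt_omega0.1 hd
  obtain ⟨x, hx, hxp, hle⟩ := exists_le_branchRank
    (((natCast_lt_of_isSuccLimit hl (n + 1))).trans_le hpv)
  obtain ⟨a, b, hab, h⟩ := exists_add_le_branchRank hx hle (hback x hx hxp)
  calc o ≤ l + n := hod
    _ < l + (n + 1 : ℕ) := by simp
    _ ≤ branchRank T a b := h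
    _ ≤ 1 + branchRank T a b := le_add_self
    _ ≤ crOrdinal T := (crOrdinal_le_iff hT).1 le_rfl a b hab

theorem crOrdinal_eq_add_omega0 (hT : T.IsTree) {t : V} {l : Ordinal.{u}} (hl : Order.IsSuccLimit l)
    (h : l ≤ branchRank T t t) (h' : branchRank T t t < l + ω) : crOrdinal T = l + ω :=
  (crOrdinal_le_add_omega0 hT hl h').antisymm (add_omega0_le_crOrdinal hT hl h)

theorem crOrdinal_finite_or (hT : T.IsTree) :
    (∃ n : ℕ, crOrdinal T = n) ∨ ∃ l : Ordinal.{u}, Order.IsSuccLimit l ∧ crOrdinal T = l + ω := by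
  obtain ⟨t⟩ := hT.1.nonempty
  rcases lt_or_ge (branchRank T t t) ω with h | h
  · exact Or.inl (lt_omega0.1 (crOrdinal_lt_omega0 hT t h))
  · set R := branchRank T t t with hR
    have hpos : 0 < R / ω := (div_pos omega0_ne_zero).2 h
    have hl : Order.IsSuccLimit (ω * (R / ω)) :=
      isSuccLimit_mul_left isSuccLimit_omega0 hpos
    refine Or.inr ⟨_, hl, crOrdinal_eq_add_omega0 (t := t) hT hl (mul_div_le R ω) ?_⟩
    rw [← hR]
    exact lt_mul_div_add R omega0_ne_zero

end Values


/-! ### Trees of lists -/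

section ListTree

variable {X : Type u} {P : List X → Prop}

/-- The graph on the lists satisfying `P` in which a list is joined to its tail. If `P` holds for
`[]` and passes to tails, this is a tree; it is thought of as rooted at `[]`. -/
def listTree (P : List X → Prop) : SimpleGraph {l : List X // P l} where
  Adj a b := (∃ z, b.1 = z :: a.1) ∨ ∃ z, a.1 = z :: b.1
  symm := ⟨fun _ _ h => h.symm⟩
  loopless := ⟨fun a h => by
    rcases h with ⟨z, h⟩ | ⟨z, h⟩ <;> simpa using congrArg List.length h⟩

/-- After the edge between `b` and its tail has been deleted, only lists with suffix `b` can be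
reached from `b`. -/
theorem suffix_of_reachable_deleteEdges {a b c : {l : List X // P l}} {z : X}
    (hb : b.1 = z :: a.1) (h : ((listTree P).deleteEdges {s(b, a)}).Reachable b c) :
    b.1 <:+ c.1 := by
  obtain ⟨w⟩ := h
  suffices key : ∀ {x y}, ((listTree P).deleteEdges {s(b, a)}).Walk x y → b.1 <:+ x.1 →
      b.1 <:+ y.1 from key w List.suffix_rfl
  intro x y w
  induction w with
  | nil => exact id
  | @cons x y _ hxy _ ih =>
    intro hx
    refine ih ?_
    rw [SimpleGraph.deleteEdges_adj] at hxy
    obtain ⟨⟨t, hy⟩ | ⟨t, hy⟩, hne⟩ := hxy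
    · exact hy ▸ hx.trans (List.suffix_cons _ _)
    · rw [hy, List.suffix_cons_iff] at hx
      refine hx.resolve_left fun hbx => hne ?_
      have hya : y = a := Subtype.ext (List.cons.inj (hb.symm.trans hbx)).2.symm
      have hxb : x = b := Subtype.ext (hy.trans hbx.symm)
      rw [hya, hxb]
      rfl

theorem listTree_isTree (hnil : P []) (htail : ∀ z l, P (z :: l) → P l) :
    (listTree P).IsTree := by
  have hreach : ∀ l (hl : P l), (listTree P).Reachable ⟨l, hl⟩ ⟨[], hnil⟩ := by
    intro l
    induction l with
    | nil => exact fun _ => SimpleGraph.Reachable.refl _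
    | cons z l ih =>
      intro hl
      have hadj : (listTree P).Adj ⟨z :: l, hl⟩ ⟨l, htail z l hl⟩ := Or.inr ⟨z, rfl⟩
      exact hadj.reachable.trans (ih _)
  have hbridge : ∀ a b : {l : List X // P l}, (∃ z, b.1 = z :: a.1) →
      (listTree P).IsBridge s(b, a) := by
    rintro a b ⟨z, hb⟩
    rw [SimpleGraph.isBridge_iff]
    intro h
    have := (suffix_of_reachable_deleteEdges hb h).length_le
    rw [hb] at this
    simp at this
  have : Nonempty {l : List X // P l} := ⟨⟨[], hnil⟩⟩
  refine ⟨⟨fun a b => (hreach a.1 a.2).trans (hreach b.1 b.2).symm⟩, ?_⟩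
  rw [SimpleGraph.isAcyclic_iff_forall_adj_isBridge]
  rintro a b (h | h)
  · exact Sym2.eq_swap ▸ hbridge a b h
  · exact hbridge b a h

theorem exists_eq_cons_of_onward {p a c : {l : List X // P l}} (hp : p.1 = a.1.tail)
    (h : (listTree P).Adj a c) (hne : c ≠ p) : ∃ z, c.1 = z :: a.1 := by
  refine h.resolve_right fun ⟨z, hz⟩ => hne (Subtype.ext ?_)
  rw [hp, hz, List.tail_cons]

theorem listTree_acc {μ : List X → Ordinal.{u}} (hlt : ∀ z l, P (z :: l) → μ (z :: l) < μ l)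
    {p a : {l : List X // P l}} (hp : p.1 = a.1.tail) : Acc (Onward (listTree P)) (p, a) := by
  induction h : μ a.1 using WellFoundedLT.induction generalizing p a with
  | ind o ih =>
    subst h
    refine ⟨_, fun ⟨a', c⟩ hq => ?_⟩
    obtain ⟨ha, hadj, hne⟩ := hq
    obtain rfl : a' = a := ha
    obtain ⟨z, hz⟩ := exists_eq_cons_of_onward hp hadj hne
    exact ih _ (hz ▸ hlt z _ (hz ▸ c.2)) (by rw [hz, List.tail_cons]) rfl

theorem listTree_rayless (hnil : P []) (htail : ∀ z l, P (z :: l) → P l) {μ : List X → Ordinal.{u}}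
    (hlt : ∀ z l, P (z :: l) → μ (z :: l) < μ l) : Rayless (listTree P) :=
  rayless_of_acc (listTree_isTree hnil htail) (t := ⟨[], hnil⟩) (listTree_acc hlt rfl)

/-- A function `μ` with `μ l = sup (μ (z :: l) + 1)` for all lists `l` in the tree computes the
ranks of the branches pointing away from the root; as `[].tail = []`, this includes the rank of the
whole tree. -/
theorem listTree_branchRank [IsWellFounded _ (Onward (listTree P))] {μ : List X → Ordinal.{u}}
    (hlt : ∀ z l, P (z :: l) → μ (z :: l) < μ l)
    (hex : ∀ l, P l → ∀ o < μ l, ∃ z, P (z :: l) ∧ o ≤ μ (z :: l))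
    {p a : {l : List X // P l}} (hp : p.1 = a.1.tail) :
    branchRank (listTree P) p a = μ a.1 := by
  induction h : μ a.1 using WellFoundedLT.induction generalizing p a with
  | ind o ih =>
    subst h
    refine (branchRank_le fun c hc hne => ?_).antisymm (le_of_forall_lt fun o ho => ?_)
    · obtain ⟨z, hz⟩ := exists_eq_cons_of_onward hp hc hne
      have h := hlt z a.1 (hz ▸ c.2)
      rw [← hz] at h
      rwa [ih _ h (by rw [hz, List.tail_cons]) rfl]
    · obtain ⟨z, hz, hle⟩ := hex a.1 a.2 o ho
      have hac : (listTree P).Adj a ⟨z :: a.1, hz⟩ := Or.inl ⟨z, rfl⟩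
      refine lt_of_le_of_lt ?_ (branchRank_lt hac fun heq => ?_)
      · rw [ih _ (hlt z a.1 hz) (List.tail_cons).symm rfl]
        exact hle
      · have := congrArg (fun l => l.1.length) heq
        simp [hp] at this
        omega

end ListTree

/-! ### Realizing the values -/

section Realize

open Ordinal

/-- The lists of length at most `n` over a one-element type form a path with `n` edges. -/
theorem natCast_mem_treeCROrdinals (n : ℕ) : (n : Ordinal.{u}) ∈ treeCROrdinals.{u} := by
  let P : List PUnit.{u + 1} → Prop := fun l => l.length ≤ n
  let μ : List PUnit.{u + 1} → Ordinal.{u} := fun l => (n - l.length : ℕ)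
  have hnil : P [] := Nat.zero_le _
  have htail : ∀ z l, P (z :: l) → P l := fun z l (h : l.length + 1 ≤ n) => (by omega : l.length ≤ n)
  have hlt : ∀ z l, P (z :: l) → μ (z :: l) < μ l := by
    intro z l (h : l.length + 1 ≤ n)
    have : n - (l.length + 1) < n - l.length := by omega
    exact Nat.cast_lt.2 this
  have hex : ∀ l, P l → ∀ o < μ l, ∃ z, P (z :: l) ∧ o ≤ μ (z :: l) := by
    intro l _ o ho
    obtain ⟨k, rfl⟩ := lt_omega0.1 (ho.trans (natCast_lt_omega0 _))
    have hk : k < n - l.length := Nat.cast_lt.1 ho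
    refine ⟨⟨⟩, (by omega : l.length + 1 ≤ n), ?_⟩
    have : k ≤ n - (l.length + 1) := by omega
    exact Nat.cast_le.2 this
  have hT := listTree_isTree hnil htail
  have hray := listTree_rayless hnil htail hlt
  have : IsWellFounded _ (Onward (listTree P)) := ⟨wellFounded_of_rayless hT hray⟩
  refine ⟨_, listTree P, hT, (copWin_iff_rayless hT).2 hray, le_antisymm ?_ ?_⟩
  · have hinward : ∀ k : ℕ, ∀ a b : {l // P l}, (∃ z, a.1 = z :: b.1) → b.1.length = k →
        branchRank (listTree P) a b ≤ k := by
      intro k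
      induction k with
      | zero =>
        rintro a b ⟨z, ha⟩ hb
        refine branchRank_le fun c hbc hca => absurd (Subtype.ext ?_) hca
        obtain ⟨z', hc⟩ | ⟨z', hc⟩ := hbc
        · exact hc.trans ha.symm
        · simp [hc] at hb
      | succ k ih =>
        rintro a b ⟨z, ha⟩ hb
        refine branchRank_le fun c hbc hca => ?_
        obtain ⟨z', hc⟩ | ⟨z', hc⟩ := hbc
        · exact absurd (Subtype.ext (hc.trans ha.symm)) hca
        · refine (ih b c ⟨z', hc⟩ ?_).trans_lt (by exact_mod_cast k.lt_succ_self)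
          simpa [hc] using hb
    refine (crOrdinal_le_iff hT).2 fun a b hab => ?_
    obtain ⟨z, hz⟩ | ⟨z, hz⟩ := hab
    · rw [listTree_branchRank hlt hex (p := a) (a := b) (by rw [hz, List.tail_cons])]
      have hb : b.1.length ≤ n := b.2
      have hb' : b.1.length = a.1.length + 1 := by rw [hz, List.length_cons]
      have : 1 + (n - b.1.length) ≤ n := by omega
      change 1 + ((n - b.1.length : ℕ) : Ordinal.{u}) ≤ n
      exact_mod_cast this
    · refine (add_le_add_right (hinward _ a b ⟨z, hz⟩ rfl) 1).trans ?_
      have ha : a.1.length ≤ n := a.2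
      rw [hz, List.length_cons, add_comm] at ha
      exact_mod_cast ha
  · cases n with
    | zero => simp
    | succ m =>
      have hone : P [⟨⟩] := Nat.succ_le_succ (Nat.zero_le m)
      have h := (crOrdinal_le_iff hT).1 le_rfl ⟨[], hnil⟩ ⟨[⟨⟩], hone⟩ (Or.inl ⟨⟨⟩, rfl⟩)
      rw [listTree_branchRank hlt hex rfl] at h
      refine le_trans (le_of_eq ?_) h
      simp only [μ, List.length_singleton, Nat.add_sub_cancel]
      rw [add_comm m, Nat.cast_add, Nat.cast_one]

/-- The tree of strictly descending sequences of ordinals below `l`, each written with its last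
entry first, has rank `l` as seen from its root. -/
theorem add_omega0_mem_treeCROrdinals {l : Ordinal.{u}} (hl : Order.IsSuccLimit l) :
    l + ω ∈ treeCROrdinals.{u} := by
  let P : List l.ToType → Prop := List.IsChain (· < ·)
  let μ : List l.ToType → Ordinal.{u} := fun s => (s.head?.map fun x => (x.toOrd : Ordinal)).getD l
  have hcons : ∀ x, μ [x] < l := fun x => x.toOrd.2
  have hnil : P [] := List.isChain_nil
  have htail : ∀ z s, P (z :: s) → P s := fun z s h => List.IsChain.tail h
  have hlt : ∀ z s, P (z :: s) → μ (z :: s) < μ s := by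
    rintro z (_ | ⟨y, s⟩) h
    · exact hcons z
    · have hzy : z < y := (List.isChain_cons_cons.1 h).1
      exact ToType.mk.symm.lt_iff_lt.2 hzy
  have hex : ∀ s, P s → ∀ o < μ s, ∃ z, P (z :: s) ∧ o ≤ μ (z :: s) := by
    rintro (_ | ⟨y, s⟩) hs o ho
    · exact ⟨ToType.mk ⟨o, ho⟩, List.isChain_singleton _, by simp [μ]⟩
    · refine ⟨ToType.mk ⟨o, ho.trans (hcons y)⟩, List.isChain_cons_cons.2 ⟨?_, hs⟩, by simp [μ]⟩
      rw [← OrderIso.lt_symm_apply]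
      exact ho
  have hT := listTree_isTree hnil htail
  have hray := listTree_rayless hnil htail hlt
  have : IsWellFounded _ (Onward (listTree P)) := ⟨wellFounded_of_rayless hT hray⟩
  have hrank : branchRank (listTree P) ⟨[], hnil⟩ ⟨[], hnil⟩ = l :=
    listTree_branchRank hlt hex rfl
  refine ⟨_, listTree P, hT, (copWin_iff_rayless hT).2 hray,
    crOrdinal_eq_add_omega0 hT hl hrank.ge (hrank.trans_lt ?_)⟩
  exact lt_add_of_pos_right l omega0_pos

end Realize

end CopsRobbers

theorem theorem3p1 :
    -- a tree is cop-win if and only if it is rayless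
    (∀ (V : Type u) (T : SimpleGraph V), T.IsTree →
      (CopsRobbers.CopWin T ↔ CopsRobbers.Rayless T)) ∧
    -- the CR-ordinal of a cop-win tree is finite or of the form `α + ω` with `α` a limit ordinal
    (∀ (V : Type u) (T : SimpleGraph V), T.IsTree → CopsRobbers.CopWin T →
      ((∃ n : ℕ, CopsRobbers.crOrdinal T = (n : Ordinal.{u})) ∨
        ∃ α : Ordinal.{u}, Order.IsSuccLimit α ∧
          CopsRobbers.crOrdinal T = α + Ordinal.omega0.{u})) ∧
    -- all these ordinals occur
    CopsRobbers.treeCROrdinals.{u} =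
      Set.Iio Ordinal.omega0.{u} ∪
        {ρ | ∃ α : Ordinal.{u}, Order.IsSuccLimit α ∧ ρ = α + Ordinal.omega0.{u}} := by
  have hvalues : ∀ (V : Type u) (T : SimpleGraph V), T.IsTree → CopsRobbers.CopWin T →
      ((∃ n : ℕ, CopsRobbers.crOrdinal T = (n : Ordinal.{u})) ∨
        ∃ α : Ordinal.{u}, Order.IsSuccLimit α ∧
          CopsRobbers.crOrdinal T = α + Ordinal.omega0.{u}) := by
    intro V T hT hwin
    have : IsWellFounded (V × V) (CopsRobbers.Onward T) :=
      ⟨CopsRobbers.wellFounded_of_rayless hT (CopsRobbers.rayless_of_copWin hT hwin)⟩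
    exact CopsRobbers.crOrdinal_finite_or hT
  refine ⟨fun V T hT => CopsRobbers.copWin_iff_rayless hT, hvalues, Set.Subset.antisymm ?_ ?_⟩
  · rintro _ ⟨V, T, hT, hwin, rfl⟩
    exact (hvalues V T hT hwin).imp Ordinal.lt_omega0.2 id
  · rintro ρ (hρ | ⟨α, hα, rfl⟩)
    · obtain ⟨n, rfl⟩ := Ordinal.lt_omega0.1 hρ
      exact CopsRobbers.natCast_mem_treeCROrdinals n
    · exact CopsRobbers.add_omega0_mem_treeCROrdinals hα
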